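/- Let $\Omega\subset\mathbb{R}^2$, let $\boldsymbol{u}=(u,v,w)^{\mathrm T}:\Omega\to\mathbb{R}^3$ be a three-channel planar image, and let $\boldsymbol{x}_0$ be an interior point of $\Omega$ such that $\boldsymbol{u}$ is twice continuously differentiable near $\boldsymbol{x}_0$ and the $3\times2$ Jacobian $\boldsymbol{D}=\mathrm{D}\boldsymbol{u}(\boldsymbol{x}_0)=(\partial_x\boldsymbol{u}\,|\,\partial_y\boldsymbol{u})$ has rank $2$. Put $$\boldsymbol{D}_3=\bigl(\partial_x\boldsymbol{u}\,\big|\,\partial_y\boldsymbol{u}\,\big|\,\partial_x\boldsymbol{u}\times\partial_y\boldsymbol{u}\bigr)(\boldsymbol{x}_0),\qquad \boldsymbol{A}=\boldsymbol{D}_3\,\mathrm{diag}(1,-1,0)\,\boldsymbol{D}_3^{-1},\qquad \boldsymbol{B}=\boldsymbol{D}_3\begin{pmatrix}0&1&0\\1&0&0\\0&0&0\end{pmatrix}\boldsymbol{D}_3^{-1}.$$ For $\varrho>0$ let $D_\varrho$ be the disc of radius $\varrho$ about the origin. One step of the affine equivariant transformed $L^1$ median filter with structuring element $D_\varrho$ at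 $\boldsymbol{x}_0$ is defined by $$\boldsymbol{u}^*_\varrho(\boldsymbol{x}_0)=\boldsymbol{D}_3\,\hat{\boldsymbol{u}}^*,\qquad \hat{\boldsymbol{u}}^*=\mathop{\mathrm{argmin}}_{\boldsymbol{z}\in\mathbb{R}^3}\int_{(\boldsymbol{x}_0+D_\varrho)\cap\Omega}\bigl\lVert\boldsymbol{D}_3^{-1}\boldsymbol{u}(\boldsymbol{x})-\boldsymbol{z}\bigr\rVert\,\mathrm{d}\boldsymbol{x}$$ with the Euclidean norm. Then for all sufficiently small $\varrho>0$ the minimiser exists and is unique, so that $\boldsymbol{u}^*_\varrho(\boldsymbol{x}_0)$ is well defined, and as $\varrho\to0$ the filter step approximates an explicit time step of size $\tau=\varrho^2/24$ of the PDE system $$\boldsymbol{u}_t=2(\boldsymbol{u}_{xx}+\boldsymbol{u}_{yy})+\boldsymbol{A}\,(\boldsymbol{u}_{yy}-\boldsymbol{u}_{xx})-2\,\boldsymbol{B}\,\boldsymbol{u}_{xy},$$ that is, $$\boldsymbol{u}^*_\varrho(\boldsymbol{x}_0)=\boldsymbol{u}(\boldsymbol{x}_0)+\frac{\varrho^2}{24}\Bigl(2(\boldsymbol{u}_{xx}+\boldsymbol{u}_{yy})+\boldsymbol{A}(\boldsymbol{u}_{yy}-\boldsymbol{u}_{xx})-2\boldsymbol{B}\boldsymbol{u}_{xy}\Bigr)(\boldsymbol{x}_0)+o(\varrho^2)\qquad(\varrho\to0^+).$$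 -/

import Mathlib

open Filter Topology Asymptotics MeasureTheory
open scoped Matrix

noncomputable section

/-- The image plane `ℝ²` with its Euclidean structure. -/
abbrev ImgPlane : Type := EuclideanSpace ℝ (Fin 2)

/-- The space `ℝ³` of the values of a three-channel image, with its Euclidean structure. -/
abbrev ChanSpace : Type := EuclideanSpace ℝ (Fin 3)

/-- The partial derivative `∂ⱼ u` of a three-channel planar image (`j = 0` is `∂ₓ`, `j = 1` is
`∂_y`), as a function on the plane. -/
def imgPartial (j : Fin 2) (u : ImgPlane → ChanSpace) (x : ImgPlane) : ChanSpace :=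
  fderiv ℝ u x (EuclideanSpace.single j 1)

/-- The `3 × 2` Jacobian `Du(x) = (∂ₓ u | ∂_y u)`. -/
def imgJacobian (u : ImgPlane → ChanSpace) (x : ImgPlane) : Matrix (Fin 3) (Fin 2) ℝ :=
  Matrix.of fun i j => imgPartial j u x i

/-- The enlarged Jacobian: the columns of `D` followed by their cross product. -/
def enlargedJacobian (D : Matrix (Fin 3) (Fin 2) ℝ) : Matrix (Fin 3) (Fin 3) ℝ :=
  (Matrix.of ![D.col 0, D.col 1, crossProduct (D.col 0) (D.col 1)])ᵀ

/-- The action of a `3 × 3` matrix on channel vectors. -/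
def chanApply (M : Matrix (Fin 3) (Fin 3) ℝ) (v : ChanSpace) : ChanSpace :=
  WithLp.toLp 2 (M *ᵥ v.ofLp)

/-- The coefficient matrix `A(D) = D₃ diag(1, -1, 0) D₃⁻¹`. -/
def coeffMatA (D : Matrix (Fin 3) (Fin 2) ℝ) : Matrix (Fin 3) (Fin 3) ℝ :=
  enlargedJacobian D * Matrix.diagonal ![1, -1, 0] * (enlargedJacobian D)⁻¹

/-- The coefficient matrix `B(D) = D₃ (0 1 0; 1 0 0; 0 0 0) D₃⁻¹`. -/
def coeffMatB (D : Matrix (Fin 3) (Fin 2) ℝ) : Matrix (Fin 3) (Fin 3) ℝ :=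
  enlargedJacobian D * !![0, 1, 0; 1, 0, 0; 0, 0, 0] * (enlargedJacobian D)⁻¹

/-- The right-hand side of the PDE system
`u_t = 2 (u_xx + u_yy) + A(Du) (u_yy - u_xx) - 2 B(Du) u_xy` at the point `x`. -/
def medianPdeRhs (u : ImgPlane → ChanSpace) (x : ImgPlane) : ChanSpace :=
  let uxx := imgPartial 0 (imgPartial 0 u) x
  let uyy := imgPartial 1 (imgPartial 1 u) x
  let uxy := imgPartial 1 (imgPartial 0 u) x
  (2 : ℝ) • (uxx + uyy) + chanApply (coeffMatA (imgJacobian u x)) (uyy - uxx)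
    - (2 : ℝ) • chanApply (coeffMatB (imgJacobian u x)) uxy

/-- `m` is an `L¹` median of the values `f x`, `x ∈ S` (with `x` uniformly distributed on `S`):
it minimises the integral of the Euclidean distances to the data. -/
def IsL1Median (f : ImgPlane → ChanSpace) (S : Set ImgPlane) (m : ChanSpace) : Prop :=
  IntegrableOn f S ∧ ∀ z : ChanSpace, ∫ x in S, ‖f x - m‖ ≤ ∫ x in S, ‖f x - z‖

/-- `z` is a value at `x₀` of the affine equivariant transformed `L¹` median filter with structuring
element the disc of radius `ρ`, applied to the image `u` on the domain `Ω`: the data in `x₀ + D_ρ`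
are transformed by `D₃(x₀)⁻¹`, an `L¹` median is taken, and it is transformed back by `D₃(x₀)`.
Only the values of `u` on `Ω` enter. -/
def IsAffineL1MedianValue (Ω : Set ImgPlane) (u : ImgPlane → ChanSpace) (ρ : ℝ)
    (x₀ : ImgPlane) (z : ChanSpace) : Prop :=
  ∃ m : ChanSpace,
    IsL1Median (fun x => chanApply (enlargedJacobian (imgJacobian u x₀))⁻¹ (u x))
      (Metric.closedBall x₀ ρ ∩ Ω) m ∧
    z = chanApply (enlargedJacobian (imgJacobian u x₀)) m

end

/-! Transformed by the inverse of `enlargedJacobian`, the image `f` has derivative `planeEmb` at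
`x₀`, and f(x₀ + ρy) = f(x₀) + ρ·planeEmb y + ρ²·q_ρ(y), with q_ρ tending uniformly on the unit disc
to half the Hessian form `planeQuad`. For a candidate f(x₀) + ρ²ζ the objective is ρ³ ∫ ‖planeEmb y
+ ρ(q_ρ(y) - ζ)‖. When the norm is expanded at planeEmb y, ζ is absent at order 0 and integrates to
zero at order 1 by oddness, so it is first seen at relative order ρ². There the limit is a positive
definite quadratic polynomial in ζ with minimum at `medianShift` (`setIntegral_normSnd_sub`).

The expansion degenerates at y = 0, but its remainder is dominated by a multiple of 1/‖y‖, which is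
integrable in the plane. Convergence therefore holds, jointly in ρ and ζ
(`tendsto_setIntegral_normRem`), and compactness makes the objective larger on a whole sphere about
`medianShift` than at its centre (`eventually_lt_sphere_medianShift`). Convexity then traps all
minimisers in the ball. Two distinct medians would force `f` to map the open disc into a line,
contradicting injectivity of its derivative (`l1Median_unique`). Transforming back conjugates the
coefficients of `medianShift` into A and B. -/

/-! ### Taylor expansion -/

/-- Second-order Taylor expansion with Peano remainder. -/
theorem ContDiffAt.second_order_taylor {E F : Type*} [NormedAddCommGroup E] [NormedSpace ℝ E]
    [NormedAddCommGroup F] [NormedSpace ℝ F] {f : E → F} {x : E} (hf : ContDiffAt ℝ 2 f x) :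
    (fun h => f (x + h) - f x - fderiv ℝ f x h - (1 / 2 : ℝ) • fderiv ℝ (fderiv ℝ f) x h h)
      =o[𝓝 0] fun h => ‖h‖ ^ 2 := by
  have hsymm : IsSymmSndFDerivAt ℝ f x := hf.isSymmSndFDerivAt (by simp)
  have hd : ∀ᶠ y in 𝓝 x, DifferentiableAt ℝ f y := by
    filter_upwards [hf.eventually (by simp)] with y hy using hy.differentiableAt (by simp)
  have hd2 : DifferentiableAt ℝ (fderiv ℝ f) x :=
    (hf.fderiv_right (m := 1) (by norm_num)).differentiableAt (by simp)
  have hadd : Tendsto (fun h : E => x + h) (𝓝 0) (𝓝 x) := by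
    have : Continuous fun h : E => x + h := by fun_prop
    simpa using this.tendsto 0
  have hlo := hd2.hasFDerivAt.isLittleO.comp_tendsto hadd
  rw [isLittleO_iff]
  intro c hc
  have hev := (hadd.eventually hd).and (hlo.def hc)
  obtain ⟨r, hr, hball⟩ := Metric.eventually_nhds_iff_ball.1 hev
  filter_upwards [Metric.ball_mem_nhds (0 : E) hr] with h hh
  set g : E → F := fun h =>
    f (x + h) - f x - fderiv ℝ f x h - (1 / 2 : ℝ) • fderiv ℝ (fderiv ℝ f) x h h with hg
  have hsub : Metric.closedBall (0 : E) ‖h‖ ⊆ Metric.ball 0 r :=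
    Metric.closedBall_subset_ball (by simpa using hh)
  have hder : ∀ k ∈ Metric.closedBall (0 : E) ‖h‖, HasFDerivWithinAt g
      (fderiv ℝ f (x + k) - fderiv ℝ f x - fderiv ℝ (fderiv ℝ f) x k)
      (Metric.closedBall (0 : E) ‖h‖) k := by
    intro k hk
    have h1 := (hball k (hsub hk)).1
    have h2 : HasFDerivAt (fun k => f (x + k)) (fderiv ℝ f (x + k)) k := by
      simpa [Function.comp_def] using h1.hasFDerivAt.comp k ((hasFDerivAt_id k).const_add x)
    have h3 : HasFDerivAt (fun k => fderiv ℝ (fderiv ℝ f) x k k)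
        (fderiv ℝ (fderiv ℝ f) x k + (fderiv ℝ (fderiv ℝ f) x).flip k) k := by
      have := (fderiv ℝ (fderiv ℝ f) x).hasFDerivAt (x := k) |>.clm_apply (hasFDerivAt_id k)
      simpa using this
    have h4 := ((h2.sub_const (f x)).sub (fderiv ℝ f x).hasFDerivAt).sub
      (h3.const_smul (1 / 2 : ℝ))
    refine (h4.congr_fderiv ?_).hasFDerivWithinAt
    -- Symmetry of the second derivative merges the two terms of the product rule, cancelling the
    -- factor 1/2.
    ext v
    have := hsymm.eq k v
    simp only [sub_apply, smul_apply, add_apply, ContinuousLinearMap.flip_apply, this]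
    module
  have hbound : ∀ k ∈ Metric.closedBall (0 : E) ‖h‖,
      ‖fderiv ℝ f (x + k) - fderiv ℝ f x - fderiv ℝ (fderiv ℝ f) x k‖ ≤ c * ‖h‖ := by
    intro k hk
    have h1 := (hball k (hsub hk)).2
    simp only [Function.comp_def, add_sub_cancel_left] at h1
    exact h1.trans (by gcongr; simpa using hk)
  -- Mean value inequality: a derivative bounded by c‖h‖ along a path of length ‖h‖.
  have := (convex_closedBall (0 : E) ‖h‖).norm_image_sub_le_of_norm_hasFDerivWithin_le hder hbound
    (x := 0) (y := h) (by simp) (by simp)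
  have hg0 : g 0 = 0 := by simp [hg]
  rw [hg0, sub_zero, sub_zero] at this
  rw [Real.norm_of_nonneg (by positivity)]
  calc ‖g h‖ ≤ c * ‖h‖ * ‖h‖ := this
    _ = c * ‖h‖ ^ 2 := by ring

/-! ### Polar coordinates and trigonometric integrals -/

theorem norm_polar (r θ : ℝ) (hr : 0 ≤ r) :
    ‖(!₂[r * Real.cos θ, r * Real.sin θ] : ImgPlane)‖ = r := by
  rw [EuclideanSpace.norm_eq, Real.sqrt_eq_iff_mul_self_eq (by positivity) hr]
  simp [Fin.sum_univ_two]
  nlinarith [Real.sin_sq_add_cos_sq θ]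

/-- Integration over the closed unit disc in polar coordinates. -/
theorem setIntegral_closedBall_eq_polar {g : ImgPlane → ℝ} {H : ℝ → ℝ → ℝ}
    (hH : Continuous fun p : ℝ × ℝ => H p.1 p.2)
    (hg : ∀ r θ, 0 < r → r ≤ 1 → r * g !₂[r * Real.cos θ, r * Real.sin θ] = H r θ) :
    ∫ y in Metric.closedBall (0 : ImgPlane) 1, g y
      = ∫ r in (0 : ℝ)..1, ∫ θ in (-Real.pi)..Real.pi, H r θ := by
  have hmp : MeasurePreserving
      (fun p : ℝ × ℝ => (WithLp.toLp 2 ((MeasurableEquiv.finTwoArrow (α := ℝ)).symm p) : ImgPlane)) :=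
    (PiLp.volume_preserving_toLp (Fin 2)).comp (volume_preserving_finTwoArrow ℝ).symm
  have hemb : MeasurableEmbedding
      (fun p : ℝ × ℝ => (WithLp.toLp 2 ((MeasurableEquiv.finTwoArrow (α := ℝ)).symm p) : ImgPlane)) :=
    ((MeasurableEquiv.finTwoArrow (α := ℝ)).symm.trans
      (MeasurableEquiv.toLp 2 (Fin 2 → ℝ))).measurableEmbedding
  rw [← integral_indicator Metric.isClosed_closedBall.measurableSet,
    ← hmp.integral_comp hemb, ← integral_comp_polarCoord_symm]
  -- Only the integrand times the Jacobian factor r has to extend continuously, so a 1/‖y‖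
  -- singularity is allowed.
  have hset : ∀ p ∈ polarCoord.target,
      p.1 • (Metric.closedBall (0 : ImgPlane) 1).indicator g
        (WithLp.toLp 2 ((MeasurableEquiv.finTwoArrow (α := ℝ)).symm (polarCoord.symm p)))
      = (Set.Ioc (0 : ℝ) 1 ×ˢ Set.Ioo (-Real.pi) Real.pi).indicator (fun p => H p.1 p.2) p := by
    rintro ⟨r, θ⟩ hp
    simp only [polarCoord_target, Set.mem_prod, Set.mem_Ioi] at hp
    have hy : (WithLp.toLp 2 ((MeasurableEquiv.finTwoArrow (α := ℝ)).symm
        (polarCoord.symm (r, θ))) : ImgPlane) = !₂[r * Real.cos θ, r * Real.sin θ] := by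
      ext i; fin_cases i <;> simp [polarCoord_symm_apply, MeasurableEquiv.finTwoArrow]
    have hn := norm_polar r θ (le_of_lt hp.1)
    rw [hy]
    by_cases hr : r ≤ 1
    · rw [Set.indicator_of_mem (by simpa [hn] using hr), Set.indicator_of_mem
        (show (r, θ) ∈ Set.Ioc (0 : ℝ) 1 ×ˢ Set.Ioo (-Real.pi) Real.pi from ⟨⟨hp.1, hr⟩, hp.2⟩)]
      exact hg r θ hp.1 hr
    · rw [Set.indicator_of_notMem (by simpa [hn] using hr), Set.indicator_of_notMem, smul_zero]
      exact fun h => hr h.1.2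
  rw [setIntegral_congr_fun polarCoord.open_target.measurableSet hset,
    setIntegral_indicator (measurableSet_Ioc.prod measurableSet_Ioo)]
  have hinter : polarCoord.target ∩ Set.Ioc (0 : ℝ) 1 ×ˢ Set.Ioo (-Real.pi) Real.pi
      = Set.Ioc (0 : ℝ) 1 ×ˢ Set.Ioo (-Real.pi) Real.pi := by
    refine Set.inter_eq_right.2 fun p hp => ?_
    exact ⟨hp.1.1, hp.2⟩
  have hint : IntegrableOn (fun p : ℝ × ℝ => H p.1 p.2)
      (Set.Ioc (0 : ℝ) 1 ×ˢ Set.Ioo (-Real.pi) Real.pi) := by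
    refine (hH.continuousOn.integrableOn_compact
      (K := Set.Icc (0 : ℝ) 1 ×ˢ Set.Icc (-Real.pi) Real.pi) (isCompact_Icc.prod isCompact_Icc)).mono_set ?_
    exact Set.prod_mono Set.Ioc_subset_Icc_self Set.Ioo_subset_Icc_self
  rw [hinter, Measure.volume_eq_prod, setIntegral_prod _ (by rwa [← Measure.volume_eq_prod]),
    intervalIntegral.integral_of_le zero_le_one]
  refine setIntegral_congr_fun measurableSet_Ioc fun r _ => ?_
  simp only
  rw [intervalIntegral.integral_of_le (by linarith [Real.pi_pos]), integral_Ioc_eq_integral_Ioo]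

/-- An explicit antiderivative: only its part linear in θ survives over a period, and the monomials
with odd exponents have none. -/
theorem integral_cos_sin_polynomial (A B C D E F G K : ℝ) :
    ∫ θ in (-Real.pi)..Real.pi, (A * Real.cos θ ^ 4 + B * (Real.cos θ ^ 3 * Real.sin θ)
      + C * (Real.cos θ ^ 2 * Real.sin θ ^ 2) + D * (Real.cos θ * Real.sin θ ^ 3)
      + E * Real.sin θ ^ 4 + F * Real.cos θ ^ 2 + G * (Real.cos θ * Real.sin θ)
      + K * Real.sin θ ^ 2)
    = (3 / 4 * A + 1 / 4 * C + 3 / 4 * E + F + K) * Real.pi := by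
  have hd : ∀ θ : ℝ, HasDerivAt (fun θ : ℝ =>
      A * (Real.cos θ ^ 3 * Real.sin θ / 4 + 3 / 8 * (θ + Real.cos θ * Real.sin θ))
      - B * Real.cos θ ^ 4 / 4
      + C * ((θ + Real.cos θ * Real.sin θ) / 8 - Real.cos θ ^ 3 * Real.sin θ / 4)
      + D * Real.sin θ ^ 4 / 4
      + E * (-(Real.sin θ ^ 3 * Real.cos θ) / 4 + 3 / 8 * (θ - Real.cos θ * Real.sin θ))
      + F * ((θ + Real.cos θ * Real.sin θ) / 2) + G * Real.sin θ ^ 2 / 2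
      + K * ((θ - Real.cos θ * Real.sin θ) / 2))
      (A * Real.cos θ ^ 4 + B * (Real.cos θ ^ 3 * Real.sin θ)
      + C * (Real.cos θ ^ 2 * Real.sin θ ^ 2) + D * (Real.cos θ * Real.sin θ ^ 3)
      + E * Real.sin θ ^ 4 + F * Real.cos θ ^ 2 + G * (Real.cos θ * Real.sin θ)
      + K * Real.sin θ ^ 2) θ := by
    intro θ
    have hc := Real.hasDerivAt_cos θ
    have hs := Real.hasDerivAt_sin θ
    have hi := hasDerivAt_id θ
    have hcs := hc.mul hs
    have h3 := (hc.pow 3).mul hs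
    have := ((((((((((h3.div_const 4).add ((hi.add hcs).const_mul (3 / 8))).const_mul A).sub
      (((hc.pow 4).const_mul B).div_const 4)).add
      ((((hi.add hcs).div_const 8).sub (h3.div_const 4)).const_mul C)).add
      (((hs.pow 4).const_mul D).div_const 4)).add
      (((((hs.pow 3).mul hc).neg.div_const 4).add
        ((hi.sub hcs).const_mul (3 / 8))).const_mul E)).add
      (((hi.add hcs).div_const 2).const_mul F)).add
      (((hs.pow 2).const_mul G).div_const 2)).add
      (((hi.sub hcs).div_const 2).const_mul K))
    refine this.congr_deriv ?_
    have e : Real.sin θ ^ 2 = 1 - Real.cos θ ^ 2 := Real.sin_sq θ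
    have e3 : Real.sin θ ^ 3 = Real.sin θ * (1 - Real.cos θ ^ 2) := by rw [pow_succ, e]; ring
    have e4 : Real.sin θ ^ 4 = (1 - Real.cos θ ^ 2) ^ 2 := by rw [← e]; ring
    have e1 : Real.sin θ * Real.sin θ = 1 - Real.cos θ ^ 2 := by rw [← e]; ring
    norm_num
    ring_nf
    rw [e4, e3, e]
    ring
  rw [intervalIntegral.integral_eq_sub_of_hasDerivAt (fun θ _ => hd θ)
    (Continuous.intervalIntegrable (by fun_prop) _ _)]
  simp
  ring

/-! ### Localisation of minimisers of convex functions -/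

/-- A convex function whose values on a sphere exceed the value at the centre attains its
minimum, and only inside the sphere. -/
theorem ConvexOn.exists_forall_le_of_lt_sphere {E : Type*} [NormedAddCommGroup E] [NormedSpace ℝ E]
    [FiniteDimensional ℝ E] {G : E → ℝ} (hG : ConvexOn ℝ Set.univ G) {c : E} {δ : ℝ} (hδ : 0 < δ) (h : ∀ z ∈ Metric.sphere c δ, G c < G z) :
    (∃ m, ∀ z, G m ≤ G z) ∧ ∀ m, (∀ z, G m ≤ G z) → dist m c ≤ δ := by
  have key : ∀ z, δ < dist z c → G c < G z := by
    intro z hz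
    have hpos : 0 < dist z c := hδ.trans hz
    -- The segment from c to z meets the sphere at parameter t; convexity along it carries the
    -- strict inequality out to z.
    set t : ℝ := δ / dist z c with ht
    have ht0 : 0 < t := by positivity
    have ht1 : t < 1 := (div_lt_one hpos).2 hz
    have hp : (1 - t) • c + t • z ∈ Metric.sphere c δ := by
      rw [mem_sphere_iff_norm]
      have : (1 - t) • c + t • z - c = t • (z - c) := by module
      rw [this, norm_smul, Real.norm_of_nonneg ht0.le, ← dist_eq_norm, ht]
      field_simp
    have h1 := h _ hp
    have h2 := hG.2 (Set.mem_univ c) (Set.mem_univ z) (sub_nonneg.2 ht1.le) ht0.le (by ring)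
    simp only [smul_eq_mul] at h2
    nlinarith
  have : ProperSpace E := FiniteDimensional.proper_real E
  obtain ⟨m, hm, hmin⟩ := (isCompact_closedBall c δ).exists_isMinOn
    ⟨c, Metric.mem_closedBall_self hδ.le⟩ ((hG.continuousOn isOpen_univ).mono (Set.subset_univ _))
  refine ⟨⟨m, fun z => ?_⟩, fun m hm => ?_⟩
  · by_cases hz : dist z c ≤ δ
    · exact hmin hz
    · exact (hmin (Metric.mem_closedBall_self hδ.le)).trans (key z (not_le.1 hz)).le
  · by_contra hcon
    exact (hm c).not_gt (key m (not_le.1 hcon))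

/-! ### Second-order expansion of the norm -/

section NormExpansion

variable {V : Type*} [NormedAddCommGroup V] [InnerProductSpace ℝ V]

/-- The remainder of the first-order expansion of the norm at `Y` in the direction `v`. -/
noncomputable def normRem (Y v : V) : ℝ := ‖Y + v‖ - ‖Y‖ - inner ℝ Y v / ‖Y‖

/-- Cauchy–Schwarz for Y and Y + v. -/
theorem normRem_nonneg {Y : V} (hY : Y ≠ 0) (v : V) : 0 ≤ normRem Y v := by
  have hn : 0 < ‖Y‖ := norm_pos_iff.2 hY
  have h := real_inner_le_norm Y (Y + v)
  rw [inner_add_right, real_inner_self_eq_norm_sq] at h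
  have : normRem Y v = (‖Y‖ * ‖Y + v‖ - (‖Y‖ ^ 2 + inner ℝ Y v)) / ‖Y‖ := by
    unfold normRem; field_simp; ring
  rw [this]
  exact div_nonneg (by linarith) hn.le

/-- The gap is exactly (‖Y + v‖ - ‖Y‖)² / (2‖Y‖). This bound supplies the dominating function. -/
theorem normRem_le {Y : V} (hY : Y ≠ 0) (v : V) : normRem Y v ≤ ‖v‖ ^ 2 / (2 * ‖Y‖) := by
  have hn : 0 < ‖Y‖ := norm_pos_iff.2 hY
  have h := norm_add_sq_real Y v
  have : ‖v‖ ^ 2 / (2 * ‖Y‖) - normRem Y v = (‖Y + v‖ - ‖Y‖) ^ 2 / (2 * ‖Y‖) := by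
    unfold normRem; field_simp; nlinarith
  have h2 : 0 ≤ (‖Y + v‖ - ‖Y‖) ^ 2 / (2 * ‖Y‖) := by positivity
  linarith

/-- Multiplication by the conjugate cancels ρ², so the limit ρ → 0 can be read off by continuity. -/
theorem normRem_smul_eq {Y w : V} (hY : Y ≠ 0) {ρ : ℝ} (hρ : ρ ≠ 0)
    (hden : ‖Y + ρ • w‖ + ‖Y‖ + ρ * (inner ℝ Y w / ‖Y‖) ≠ 0) :
    normRem Y (ρ • w) / ρ ^ 2 = (‖w‖ ^ 2 - (inner ℝ Y w / ‖Y‖) ^ 2)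
      / (‖Y + ρ • w‖ + ‖Y‖ + ρ * (inner ℝ Y w / ‖Y‖)) := by
  have hn : 0 < ‖Y‖ := norm_pos_iff.2 hY
  have h := norm_add_sq_real Y (ρ • w)
  rw [inner_smul_right, norm_smul, mul_pow, Real.norm_eq_abs, sq_abs] at h
  have hs : inner ℝ Y w = (inner ℝ Y w / ‖Y‖) * ‖Y‖ := by field_simp
  rw [div_eq_div_iff (by positivity) hden, normRem, inner_smul_right, mul_div_assoc]
  generalize inner ℝ Y w / ‖Y‖ = s at *
  rw [hs] at h
  nlinarith

theorem tendsto_normRem {ι : Type*} {l : Filter ι} {Y : V} (hY : Y ≠ 0) {ρ : ι → ℝ} {w : ι → V}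
    {w₀ : V} (hρ : Tendsto ρ l (𝓝[>] 0)) (hw : Tendsto w l (𝓝 w₀)) :
    Tendsto (fun i => normRem Y (ρ i • w i) / ρ i ^ 2) l
      (𝓝 ((‖w₀‖ ^ 2 - (inner ℝ Y w₀ / ‖Y‖) ^ 2) / (2 * ‖Y‖))) := by
  have hn : 0 < ‖Y‖ := norm_pos_iff.2 hY
  have hρ0 : Tendsto ρ l (𝓝 0) := hρ.mono_right nhdsWithin_le_nhds
  have hs : Tendsto (fun i => inner ℝ Y (w i) / ‖Y‖) l (𝓝 (inner ℝ Y w₀ / ‖Y‖)) :=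
    (tendsto_const_nhds.inner hw).div_const _
  have hden : Tendsto (fun i => ‖Y + ρ i • w i‖ + ‖Y‖ + ρ i * (inner ℝ Y (w i) / ‖Y‖)) l
      (𝓝 (2 * ‖Y‖)) := by
    have := (((tendsto_const_nhds (x := Y)).add (hρ0.smul hw)).norm.add
      (tendsto_const_nhds (x := ‖Y‖))).add (hρ0.mul hs)
    convert this using 2
    simp; ring
  have hlim := ((hw.norm.pow 2).sub (hs.pow 2)).div hden (by positivity)
  refine hlim.congr' ?_
  filter_upwards [hρ.eventually self_mem_nhdsWithin, hden.eventually_ne (by positivity)]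
    with i h1 h2
  exact (normRem_smul_eq hY (ne_of_gt h1) h2).symm

end NormExpansion

/-! ### The limiting quadratic functional -/

/-- The embedding of the image plane as the coordinate plane of the first two channels. -/
noncomputable def planeEmb : ImgPlane →ₗᵢ[ℝ] ChanSpace where
  toFun y := !₂[y 0, y 1, 0]
  map_add' x y := by ext i; fin_cases i <;> simp
  map_smul' c x := by ext i; fin_cases i <;> simp
  norm_map' x := by
    simp [EuclideanSpace.norm_eq, Fin.sum_univ_two, Fin.sum_univ_three]

theorem planeEmb_apply (y : ImgPlane) : planeEmb y = !₂[y 0, y 1, 0] := rfl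

/-- The vector-valued quadratic form with coefficients `a`, `b`, `d` (half of the Hessian). -/
noncomputable def planeQuad (a b d : ChanSpace) (y : ImgPlane) : ChanSpace :=
  (1 / 2 : ℝ) • (y 0 ^ 2 • a + (2 * (y 0 * y 1)) • b + y 1 ^ 2 • d)

theorem continuous_planeQuad (a b d : ChanSpace) : Continuous (planeQuad a b d) := by
  unfold planeQuad; fun_prop

/-- The second-order displacement of the median. -/
noncomputable def medianShift (a b d : ChanSpace) : ChanSpace :=
  (1 / 24 : ℝ) • !₂[a 0 + 3 * d 0 - 2 * b 1, 3 * a 1 + d 1 - 2 * b 0, 2 * (a 2 + d 2)]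

/-- The second-order coefficient of the norm at `Y` in the direction `w`. -/
noncomputable def normSnd (Y w : ChanSpace) : ℝ :=
  (‖w‖ ^ 2 - (inner ℝ Y w / ‖Y‖) ^ 2) / (2 * ‖Y‖)

theorem chan_norm_sq (w : ChanSpace) : ‖w‖ ^ 2 = w 0 ^ 2 + w 1 ^ 2 + w 2 ^ 2 := by
  rw [EuclideanSpace.real_norm_sq_eq, Fin.sum_univ_three]

theorem inner_planeEmb (y : ImgPlane) (w : ChanSpace) :
    inner ℝ (planeEmb y) w = y 0 * w 0 + y 1 * w 1 := by
  simp [planeEmb_apply, PiLp.inner_apply, Fin.sum_univ_three]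
  ring

theorem polar_mul_normSnd (r θ : ℝ) (hr : 0 < r) (w : ChanSpace) :
    r * normSnd (planeEmb !₂[r * Real.cos θ, r * Real.sin θ]) w
      = (w 0 ^ 2 + w 1 ^ 2 + w 2 ^ 2 - (Real.cos θ * w 0 + Real.sin θ * w 1) ^ 2) / 2 := by
  have h : inner ℝ (planeEmb !₂[r * Real.cos θ, r * Real.sin θ]) w / r
      = Real.cos θ * w 0 + Real.sin θ * w 1 := by
    rw [inner_planeEmb]; simp; field_simp
  rw [normSnd, planeEmb.norm_map, norm_polar r θ hr.le, h, chan_norm_sq]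
  field_simp

/-- The terms quadratic in `planeQuad` cancel in the difference, leaving angular degree at most 4.
The Hessian in ζ is the integral of (1 - projection onto planeEmb y)/‖y‖, which is diag(π, π, 2π);
`medianShift` is the critical point, so only the completed square remains. -/
theorem setIntegral_normSnd_sub (a b d ζ : ChanSpace) :
    ∫ y in Metric.closedBall (0 : ImgPlane) 1,
      (normSnd (planeEmb y) (planeQuad a b d y - ζ)
        - normSnd (planeEmb y) (planeQuad a b d y - medianShift a b d))
    = Real.pi / 2 * ((ζ 0 - medianShift a b d 0) ^ 2 + (ζ 1 - medianShift a b d 1) ^ 2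
        + 2 * (ζ 2 - medianShift a b d 2) ^ 2) := by
  have hm0 : medianShift a b d 0 = (a 0 + 3 * d 0 - 2 * b 1) / 24 := by simp [medianShift]; ring
  have hm1 : medianShift a b d 1 = (3 * a 1 + d 1 - 2 * b 0) / 24 := by simp [medianShift]; ring
  have hm2 : medianShift a b d 2 = (a 2 + d 2) / 12 := by simp [medianShift]; ring
  set m := medianShift a b d
  have hq : ∀ (r θ : ℝ) (i : Fin 3), planeQuad a b d !₂[r * Real.cos θ, r * Real.sin θ] i
      = r ^ 2 / 2 * (Real.cos θ ^ 2 * a i + 2 * (Real.cos θ * Real.sin θ) * b i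
        + Real.sin θ ^ 2 * d i) := by
    intro r θ i
    simp [planeQuad]
    ring
  set S : ℝ := (ζ 0 ^ 2 + ζ 1 ^ 2 + ζ 2 ^ 2 - m 0 ^ 2 - m 1 ^ 2 - m 2 ^ 2) / 2 with hS
  -- The angular integral is π(P + Q r²); the constant S is written as S(cos² + sin²) to fit the
  -- trigonometric integral.
  set P : ℝ := 2 * S - (ζ 0 ^ 2 - m 0 ^ 2) / 2 - (ζ 1 ^ 2 - m 1 ^ 2) / 2 with hP
  set η : Fin 3 → ℝ := fun i => ζ i - m i with hη
  set Q : ℝ := 3 / 4 * (a 0 * η 0 / 2) + 1 / 4 * (d 0 * η 0 / 2 + b 0 * η 1 + b 1 * η 0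
    + a 1 * η 1 / 2) + 3 / 4 * (d 1 * η 1 / 2) - (a 0 * η 0 + a 1 * η 1 + a 2 * η 2) / 2
    - (d 0 * η 0 + d 1 * η 1 + d 2 * η 2) / 2 with hQ
  rw [setIntegral_closedBall_eq_polar (H := fun r θ =>
    r ^ 2 * (a 0 * η 0 / 2) * Real.cos θ ^ 4
    + r ^ 2 * (b 0 * η 0 + (a 0 * η 1 + a 1 * η 0) / 2) * (Real.cos θ ^ 3 * Real.sin θ)
    + r ^ 2 * (d 0 * η 0 / 2 + b 0 * η 1 + b 1 * η 0 + a 1 * η 1 / 2)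
      * (Real.cos θ ^ 2 * Real.sin θ ^ 2)
    + r ^ 2 * ((d 0 * η 1 + d 1 * η 0) / 2 + b 1 * η 1) * (Real.cos θ * Real.sin θ ^ 3)
    + r ^ 2 * (d 1 * η 1 / 2) * Real.sin θ ^ 4
    + (S - (ζ 0 ^ 2 - m 0 ^ 2) / 2 - r ^ 2 * (a 0 * η 0 + a 1 * η 1 + a 2 * η 2) / 2)
      * Real.cos θ ^ 2
    + (-(ζ 0 * ζ 1 - m 0 * m 1) - r ^ 2 * (b 0 * η 0 + b 1 * η 1 + b 2 * η 2))
      * (Real.cos θ * Real.sin θ)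
    + (S - (ζ 1 ^ 2 - m 1 ^ 2) / 2 - r ^ 2 * (d 0 * η 0 + d 1 * η 1 + d 2 * η 2) / 2)
      * Real.sin θ ^ 2) (by fun_prop)]
  · have hin : ∀ r : ℝ, (∫ θ in (-Real.pi)..Real.pi,
        (r ^ 2 * (a 0 * η 0 / 2) * Real.cos θ ^ 4
    + r ^ 2 * (b 0 * η 0 + (a 0 * η 1 + a 1 * η 0) / 2) * (Real.cos θ ^ 3 * Real.sin θ)
    + r ^ 2 * (d 0 * η 0 / 2 + b 0 * η 1 + b 1 * η 0 + a 1 * η 1 / 2)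
      * (Real.cos θ ^ 2 * Real.sin θ ^ 2)
    + r ^ 2 * ((d 0 * η 1 + d 1 * η 0) / 2 + b 1 * η 1) * (Real.cos θ * Real.sin θ ^ 3)
    + r ^ 2 * (d 1 * η 1 / 2) * Real.sin θ ^ 4
    + (S - (ζ 0 ^ 2 - m 0 ^ 2) / 2 - r ^ 2 * (a 0 * η 0 + a 1 * η 1 + a 2 * η 2) / 2)
      * Real.cos θ ^ 2
    + (-(ζ 0 * ζ 1 - m 0 * m 1) - r ^ 2 * (b 0 * η 0 + b 1 * η 1 + b 2 * η 2))
      * (Real.cos θ * Real.sin θ)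
    + (S - (ζ 1 ^ 2 - m 1 ^ 2) / 2 - r ^ 2 * (d 0 * η 0 + d 1 * η 1 + d 2 * η 2) / 2)
      * Real.sin θ ^ 2)) = P * Real.pi + Q * Real.pi * r ^ 2 := by
      intro r
      rw [integral_cos_sin_polynomial, hP, hQ]
      ring
    simp_rw [hin]
    rw [intervalIntegral.integral_add (by simp) (Continuous.intervalIntegrable (by fun_prop) _ _),
      intervalIntegral.integral_const_mul (Q * Real.pi), integral_pow]
    simp only [intervalIntegral.integral_const, hP, hQ, hS, hη, hm0, hm1, hm2, smul_eq_mul]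
    norm_num
    ring
  · intro r θ hr _
    rw [mul_sub, polar_mul_normSnd r θ hr, polar_mul_normSnd r θ hr]
    simp only [PiLp.sub_apply, hq, hS, hη]
    linear_combination (-(ζ 0 ^ 2 + ζ 1 ^ 2 + ζ 2 ^ 2 - m 0 ^ 2 - m 1 ^ 2 - m 2 ^ 2) / 2) * Real.sin_sq_add_cos_sq θ

/-! ### Convergence of the rescaled objective -/

/-- In dimension two the radial density r cancels the singularity 1/r. -/
theorem integrableOn_const_div_norm (C : ℝ) :
    IntegrableOn (fun y : ImgPlane => C / ‖y‖) (Metric.closedBall 0 1) := by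
  have h1 : Integrable (fun y : ImgPlane => (Set.Iic (1 : ℝ)).indicator (fun r => C / r) ‖y‖) := by
    rw [integrable_fun_norm_addHaar volume (f := (Set.Iic (1 : ℝ)).indicator (fun r => C / r))]
    have : IntegrableOn (fun _ : ℝ => C) (Set.Ioc (0 : ℝ) 1) := by
      simp
    have h2 : IntegrableOn ((Set.Iic (1 : ℝ)).indicator (fun _ => C)) (Set.Ioi 0) := by
      rw [IntegrableOn, integrable_indicator_iff measurableSet_Iic, IntegrableOn,
        Measure.restrict_restrict measurableSet_Iic, Set.Iic_inter_Ioi]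
      exact this
    refine h2.congr_fun (fun y hy => ?_) measurableSet_Ioi
    have hy' : y ≠ 0 := ne_of_gt hy
    by_cases h : y ≤ 1
    · simp [h]; field_simp
    · simp [h]
  refine (h1.integrableOn (s := Metric.closedBall 0 1)).congr_fun (fun y hy => ?_)
    Metric.isClosed_closedBall.measurableSet
  have : ‖y‖ ≤ 1 := by simpa using hy
  simp [this]

theorem ae_ne_zero_restrict (S : Set ImgPlane) : ∀ᵐ y ∂(volume.restrict S), y ≠ 0 := by
  refine ae_restrict_of_ae ?_
  simp [ae_iff]

theorem aemeasurable_normRem {q : ImgPlane → ChanSpace} {μ : Measure ImgPlane}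
    (hq : AEMeasurable q μ) :
    AEMeasurable (fun y => normRem (planeEmb y) (q y)) μ := by
  have he : AEMeasurable (fun y => planeEmb y) μ := planeEmb.continuous.measurable.aemeasurable
  unfold normRem
  exact ((he.add hq).norm.sub he.norm).sub ((he.inner hq).div he.norm)

/-- Dominated convergence. The limit is joint in (ρ, ζ), as the later compactness argument over a
sphere of ζ requires. -/
theorem tendsto_setIntegral_normRem {q : ℝ → ImgPlane → ChanSpace} {q₀ : ImgPlane → ChanSpace}
    {K : ℝ} (hcont : ∀ᶠ ρ in 𝓝[>] (0 : ℝ), ContinuousOn (q ρ) (Metric.closedBall 0 1))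
    (hbound : ∀ᶠ ρ in 𝓝[>] (0 : ℝ), ∀ y ∈ Metric.closedBall (0 : ImgPlane) 1, ‖q ρ y‖ ≤ K)
    (hlim : ∀ y ∈ Metric.closedBall (0 : ImgPlane) 1,
      Tendsto (fun ρ => q ρ y) (𝓝[>] 0) (𝓝 (q₀ y))) (ζ₀ : ChanSpace) :
    Tendsto (fun p : ℝ × ChanSpace => ∫ y in Metric.closedBall (0 : ImgPlane) 1,
        normRem (planeEmb y) (p.1 • (q p.1 y - p.2)) / p.1 ^ 2) (𝓝[>] 0 ×ˢ 𝓝 ζ₀)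
      (𝓝 (∫ y in Metric.closedBall (0 : ImgPlane) 1, normSnd (planeEmb y) (q₀ y - ζ₀))) := by
  have hB : MeasurableSet (Metric.closedBall (0 : ImgPlane) 1) :=
    Metric.isClosed_closedBall.measurableSet
  have hζ : ∀ᶠ p : ℝ × ChanSpace in 𝓝[>] 0 ×ˢ 𝓝 ζ₀, ‖p.2‖ ≤ ‖ζ₀‖ + 1 := by
    have : ∀ᶠ z in 𝓝 ζ₀, ‖z‖ < ‖ζ₀‖ + 1 :=
      (continuous_norm.tendsto ζ₀).eventually_lt_const (lt_add_one ‖ζ₀‖)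
    exact (tendsto_snd.eventually this).mono fun p hp => hp.le
  refine tendsto_integral_filter_of_dominated_convergence
    -- The bound of `normRem_le`, with ζ kept within distance that gives ‖ζ‖ ≤ ‖ζ₀‖ + 1.
    (fun y => (K + (‖ζ₀‖ + 1)) ^ 2 / 2 / ‖y‖) ?_ ?_ (integrableOn_const_div_norm _) ?_
  · filter_upwards [tendsto_fst.eventually hcont] with p hp
    have h1 : AEMeasurable (q p.1) (volume.restrict (Metric.closedBall 0 1)) :=
      hp.aemeasurable hB
    exact ((aemeasurable_normRem ((h1.sub aemeasurable_const).const_smul p.1)).div_const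
      _).aestronglyMeasurable
  · filter_upwards [tendsto_fst.eventually hbound, hζ,
      tendsto_fst.eventually (self_mem_nhdsWithin (a := (0 : ℝ)) (s := Set.Ioi 0))] with p hp hz h0
    have h0 : 0 < p.1 := h0
    filter_upwards [ae_restrict_mem hB, ae_ne_zero_restrict _] with y hy hy0
    have hY : planeEmb y ≠ 0 := fun h => hy0 (planeEmb.injective (h.trans planeEmb.map_zero.symm))
    have hn : 0 < ‖y‖ := norm_pos_iff.2 hy0
    rw [Real.norm_of_nonneg (div_nonneg (normRem_nonneg hY _) (by positivity))]
    have h1 := normRem_le hY (p.1 • (q p.1 y - p.2))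
    have h2 : ‖q p.1 y - p.2‖ ≤ K + (‖ζ₀‖ + 1) :=
      (norm_sub_le _ _).trans (add_le_add (hp y hy) hz)
    rw [planeEmb.norm_map, norm_smul, mul_pow, Real.norm_of_nonneg h0.le] at h1
    calc _ ≤ p.1 ^ 2 * ‖q p.1 y - p.2‖ ^ 2 / (2 * ‖y‖) / p.1 ^ 2 := by gcongr
      _ = ‖q p.1 y - p.2‖ ^ 2 / 2 / ‖y‖ := by field_simp
      _ ≤ _ := by gcongr
  · filter_upwards [ae_restrict_mem hB, ae_ne_zero_restrict _] with y hy hy0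
    have hY : planeEmb y ≠ 0 := fun h => hy0 (planeEmb.injective (h.trans planeEmb.map_zero.symm))
    exact tendsto_normRem hY tendsto_fst (((hlim y hy).comp tendsto_fst).sub tendsto_snd)

theorem integrableOn_normSnd {q : ImgPlane → ChanSpace}
    (hq : ContinuousOn q (Metric.closedBall 0 1)) :
    IntegrableOn (fun y => normSnd (planeEmb y) (q y)) (Metric.closedBall 0 1) := by
  have hB : MeasurableSet (Metric.closedBall (0 : ImgPlane) 1) :=
    Metric.isClosed_closedBall.measurableSet
  obtain ⟨K, hK⟩ := (isCompact_closedBall (0 : ImgPlane) 1).exists_bound_of_continuousOn hq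
  have he : AEMeasurable (fun y => planeEmb y) (volume.restrict (Metric.closedBall 0 1)) :=
    planeEmb.continuous.measurable.aemeasurable
  have hqm : AEMeasurable q (volume.restrict (Metric.closedBall 0 1)) := hq.aemeasurable hB
  refine Integrable.mono' (integrableOn_const_div_norm (K ^ 2 / 2)) ?_ ?_
  · unfold normSnd
    exact (((hqm.norm.pow_const 2).sub (((he.inner hqm).div he.norm).pow_const 2)).div
      (he.norm.const_mul 2)).aestronglyMeasurable
  · filter_upwards [ae_restrict_mem hB, ae_ne_zero_restrict _] with y hy hy0
    have hn : 0 < ‖y‖ := norm_pos_iff.2 hy0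
    have h1 : (inner ℝ (planeEmb y) (q y) / ‖planeEmb y‖) ^ 2 ≤ ‖q y‖ ^ 2 := by
      rw [sq_le_sq, abs_of_nonneg (norm_nonneg (q y)), abs_div, abs_norm, planeEmb.norm_map,
        div_le_iff₀ hn, mul_comm]
      simpa using abs_real_inner_le_norm (planeEmb y) (q y)
    have h2 : ‖q y‖ ^ 2 ≤ K ^ 2 := by gcongr; exact hK y hy
    have h3 := sq_nonneg (inner ℝ (planeEmb y) (q y) / ‖planeEmb y‖)
    unfold normSnd
    rw [Real.norm_of_nonneg (div_nonneg (by linarith) (by positivity)), planeEmb.norm_map,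
      div_div]
    rw [planeEmb.norm_map] at h3
    gcongr
    linarith

/-- The integrand is odd and the disc symmetric. This removes ζ from the first-order term. -/
theorem setIntegral_inner_planeEmb (ζ : ChanSpace) :
    ∫ y in Metric.closedBall (0 : ImgPlane) 1, inner ℝ (planeEmb y) ζ / ‖planeEmb y‖ = 0 := by
  have hB : MeasurableSet (Metric.closedBall (0 : ImgPlane) 1) :=
    Metric.isClosed_closedBall.measurableSet
  rw [← integral_indicator hB]
  set F := (Metric.closedBall (0 : ImgPlane) 1).indicator
    fun y => inner ℝ (planeEmb y) ζ / ‖planeEmb y‖ with hF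
  have hodd : ∀ y, F (-y) = -F y := by
    intro y
    by_cases hy : ‖y‖ ≤ 1
    · simp [hF, hy, neg_div]
    · simp [hF, hy]
  have h1 := integral_neg_eq_self F volume
  simp only [hodd, integral_neg] at h1
  linarith

theorem integrableOn_inner_planeEmb {q : ImgPlane → ChanSpace}
    (hq : ContinuousOn q (Metric.closedBall 0 1)) :
    IntegrableOn (fun y => inner ℝ (planeEmb y) (q y) / ‖planeEmb y‖) (Metric.closedBall 0 1) := by
  have hB : MeasurableSet (Metric.closedBall (0 : ImgPlane) 1) :=
    Metric.isClosed_closedBall.measurableSet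
  have he : AEMeasurable (fun y => planeEmb y) (volume.restrict (Metric.closedBall 0 1)) :=
    planeEmb.continuous.measurable.aemeasurable
  have hqm : AEMeasurable q (volume.restrict (Metric.closedBall 0 1)) := hq.aemeasurable hB
  have hi : IntegrableOn (fun y => ‖q y‖) (Metric.closedBall 0 1) :=
    hq.norm.integrableOn_compact (isCompact_closedBall 0 1)
  refine Integrable.mono' hi ((he.inner hqm).div he.norm).aestronglyMeasurable ?_
  filter_upwards [ae_ne_zero_restrict _] with y hy0
  have hn : 0 < ‖y‖ := norm_pos_iff.2 hy0
  rw [Real.norm_eq_abs, abs_div, abs_norm, planeEmb.norm_map, div_le_iff₀ hn, mul_comm]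
  simpa using abs_real_inner_le_norm (planeEmb y) (q y)

/-- The discarded terms are ‖planeEmb y‖, a first-order term in q that does not involve ζ, and one
in ζ that integrates to zero. -/
theorem setIntegral_norm_sub_eq {q : ImgPlane → ChanSpace}
    (hq : ContinuousOn q (Metric.closedBall 0 1)) (ρ : ℝ) (ζ₁ ζ₂ : ChanSpace) :
    (∫ y in Metric.closedBall (0 : ImgPlane) 1, ‖planeEmb y + ρ • (q y - ζ₁)‖)
      - ∫ y in Metric.closedBall (0 : ImgPlane) 1, ‖planeEmb y + ρ • (q y - ζ₂)‖
    = (∫ y in Metric.closedBall (0 : ImgPlane) 1, normRem (planeEmb y) (ρ • (q y - ζ₁)))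
      - ∫ y in Metric.closedBall (0 : ImgPlane) 1, normRem (planeEmb y) (ρ • (q y - ζ₂)) := by
  have hK := isCompact_closedBall (0 : ImgPlane) 1
  have hN : IntegrableOn (fun y : ImgPlane => ‖planeEmb y‖) (Metric.closedBall 0 1) :=
    planeEmb.continuous.norm.continuousOn.integrableOn_compact hK
  have hI := fun ζ : ChanSpace => integrableOn_inner_planeEmb (q := fun _ => ζ) continuousOn_const
  have hJ := integrableOn_inner_planeEmb hq
  have hexp : ∀ ζ : ChanSpace, ∫ y in Metric.closedBall (0 : ImgPlane) 1,
      ‖planeEmb y + ρ • (q y - ζ)‖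
      = (∫ y in Metric.closedBall (0 : ImgPlane) 1, normRem (planeEmb y) (ρ • (q y - ζ)))
        + (∫ y in Metric.closedBall (0 : ImgPlane) 1, ‖planeEmb y‖)
        + ρ * ∫ y in Metric.closedBall (0 : ImgPlane) 1,
            inner ℝ (planeEmb y) (q y) / ‖planeEmb y‖ := by
    intro ζ
    have hA : IntegrableOn (fun y => ‖planeEmb y + ρ • (q y - ζ)‖) (Metric.closedBall 0 1) :=
      (planeEmb.continuous.continuousOn.add
        ((hq.sub continuousOn_const).const_smul ρ)).norm.integrableOn_compact hK
    have hpt : ∀ y, normRem (planeEmb y) (ρ • (q y - ζ))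
        = ‖planeEmb y + ρ • (q y - ζ)‖ - ‖planeEmb y‖
          - (ρ * (inner ℝ (planeEmb y) (q y) / ‖planeEmb y‖)
            - ρ * (inner ℝ (planeEmb y) ζ / ‖planeEmb y‖)) := by
      intro y
      rw [normRem, inner_smul_right, inner_sub_right]
      ring
    simp_rw [hpt]
    rw [integral_sub, integral_sub hA hN, integral_sub (hJ.const_mul ρ) ((hI ζ).const_mul ρ),
      integral_const_mul, integral_const_mul, setIntegral_inner_planeEmb]
    · ring
    · exact hA.sub hN
    · exact (hJ.const_mul ρ).sub ((hI ζ).const_mul ρ)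
  rw [hexp, hexp]
  ring

/-- On a sphere about the second-order displacement, the rescaled objective function eventually
exceeds its value at the centre. -/
theorem eventually_lt_sphere_medianShift {q : ℝ → ImgPlane → ChanSpace} {a b d : ChanSpace}
    {K : ℝ} (hcont : ∀ᶠ ρ in 𝓝[>] (0 : ℝ), ContinuousOn (q ρ) (Metric.closedBall 0 1))
    (hbound : ∀ᶠ ρ in 𝓝[>] (0 : ℝ), ∀ y ∈ Metric.closedBall (0 : ImgPlane) 1, ‖q ρ y‖ ≤ K)
    (hlim : ∀ y ∈ Metric.closedBall (0 : ImgPlane) 1,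
      Tendsto (fun ρ => q ρ y) (𝓝[>] 0) (𝓝 (planeQuad a b d y))) {δ : ℝ} (hδ : 0 < δ) :
    ∀ᶠ ρ in 𝓝[>] (0 : ℝ), ∀ ζ ∈ Metric.sphere (medianShift a b d) δ,
      (∫ y in Metric.closedBall (0 : ImgPlane) 1,
        ‖planeEmb y + ρ • (q ρ y - medianShift a b d)‖)
      < ∫ y in Metric.closedBall (0 : ImgPlane) 1, ‖planeEmb y + ρ • (q ρ y - ζ)‖ := by
  set m := medianShift a b d with hm
  rw [eventually_nhdsWithin_iff]
  -- Stated on full neighbourhoods of (0, ζ₀), so that compactness of the sphere yields one range of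
  -- ρ valid for all ζ.
  have key : ∀ ζ₀ ∈ Metric.sphere m δ, ∀ᶠ p : ℝ × ChanSpace in 𝓝 (0, ζ₀), p.1 ∈ Set.Ioi (0 : ℝ) →
      (∫ y in Metric.closedBall (0 : ImgPlane) 1, ‖planeEmb y + p.1 • (q p.1 y - m)‖)
      < ∫ y in Metric.closedBall (0 : ImgPlane) 1, ‖planeEmb y + p.1 • (q p.1 y - p.2)‖ := by
    intro ζ₀ hζ₀
    have hlt : ∫ y in Metric.closedBall (0 : ImgPlane) 1, normSnd (planeEmb y) (planeQuad a b d y - m)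
        < ∫ y in Metric.closedBall (0 : ImgPlane) 1,
            normSnd (planeEmb y) (planeQuad a b d y - ζ₀) := by
      have hi := fun ζ : ChanSpace => integrableOn_normSnd (q := fun y => planeQuad a b d y - ζ)
        ((continuous_planeQuad a b d).sub continuous_const).continuousOn
      have h1 := setIntegral_normSnd_sub a b d ζ₀
      rw [integral_sub (hi ζ₀) (hi _), ← hm] at h1
      have h2 : ‖ζ₀ - m‖ ^ 2 = δ ^ 2 := by rw [mem_sphere_iff_norm.1 hζ₀]
      rw [chan_norm_sq] at h2
      simp only [PiLp.sub_apply] at h2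
      have h3 : 0 < Real.pi / 2 * ((ζ₀ 0 - m 0) ^ 2 + (ζ₀ 1 - m 1) ^ 2
          + 2 * (ζ₀ 2 - m 2) ^ 2) := by
        refine mul_pos (by positivity) ?_
        nlinarith [sq_nonneg (ζ₀ 2 - m 2)]
      linarith
    have t1 := tendsto_setIntegral_normRem hcont hbound hlim ζ₀
    have t2 : Tendsto (fun p : ℝ × ChanSpace => ((p.1, m) : ℝ × ChanSpace))
        (𝓝[>] 0 ×ˢ 𝓝 ζ₀) (𝓝[>] 0 ×ˢ 𝓝 m) := tendsto_fst.prodMk tendsto_const_nhds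
    have t3 := (tendsto_setIntegral_normRem hcont hbound hlim m).comp t2
    have hev := (t3.eventually_lt t1 hlt).and (tendsto_fst.eventually hcont)
    have hfil : 𝓝[>] (0 : ℝ) ×ˢ 𝓝 ζ₀ = 𝓝[Set.Ioi (0 : ℝ) ×ˢ Set.univ] (0, ζ₀) := by
      rw [nhdsWithin_prod_eq, nhdsWithin_univ]
    rw [hfil, eventually_nhdsWithin_iff] at hev
    filter_upwards [hev] with p hp h0
    obtain ⟨h1, h2⟩ := hp ⟨h0, trivial⟩
    have h0 : 0 < p.1 := h0
    simp only [Function.comp_def, integral_div] at h1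
    rw [div_lt_div_iff_of_pos_right (by positivity)] at h1
    have := setIntegral_norm_sub_eq h2 p.1 m p.2
    linarith
  have := (isCompact_sphere m δ).eventually_forall_of_forall_eventually
    (P := fun ρ ζ => ρ ∈ Set.Ioi (0 : ℝ) →
      (∫ y in Metric.closedBall (0 : ImgPlane) 1, ‖planeEmb y + ρ • (q ρ y - m)‖)
      < ∫ y in Metric.closedBall (0 : ImgPlane) 1, ‖planeEmb y + ρ • (q ρ y - ζ)‖) key
  filter_upwards [this] with ρ hρ h0 ζ hζ using hρ ζ hζ h0

/-! ### Convexity of the objective and uniqueness of the median -/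

theorem convexOn_setIntegral_norm_sub {f : ImgPlane → ChanSpace} {S : Set ImgPlane}
    (hS : IsCompact S) (hf : ContinuousOn f S) :
    ConvexOn ℝ Set.univ (fun z => ∫ x in S, ‖f x - z‖) := by
  have hi : ∀ z : ChanSpace, IntegrableOn (fun x => ‖f x - z‖) S := fun z =>
    (hf.sub continuousOn_const).norm.integrableOn_compact hS
  refine ⟨convex_univ, fun z₁ _ z₂ _ s t hs ht hst => ?_⟩
  simp only [smul_eq_mul]
  rw [← integral_const_mul, ← integral_const_mul,
    ← integral_add ((hi z₁).const_mul s) ((hi z₂).const_mul t)]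
  refine integral_mono (hi _) (((hi z₁).const_mul s).add ((hi z₂).const_mul t)) fun x => ?_
  have : f x - (s • z₁ + t • z₂) = s • (f x - z₁) + t • (f x - z₂) := by
    have h1 : f x = (s + t) • f x := by rw [hst, one_smul]
    nth_rewrite 1 [h1]
    module
  simp only [this]
  refine (norm_add_le _ _).trans_eq ?_
  rw [norm_smul, norm_smul, Real.norm_of_nonneg hs, Real.norm_of_nonneg ht]

/-- Rotate the planar part of η by a right angle; if it vanishes, any direction serves. -/
theorem exists_planeEmb_inner_eq_zero (η : ChanSpace) :
    ∃ k : ImgPlane, k ≠ 0 ∧ inner ℝ (planeEmb k) η = 0 := by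
  by_cases h : η 0 = 0 ∧ η 1 = 0
  · refine ⟨EuclideanSpace.single 0 1, by simp, ?_⟩
    simp [inner_planeEmb, h.1]
  · refine ⟨!₂[-η 1, η 0], fun h0 => h ?_, ?_⟩
    · have h1 := congrArg (fun v : ImgPlane => v 0) h0
      have h2 := congrArg (fun v : ImgPlane => v 1) h0
      simp at h1 h2
      exact ⟨h2, h1⟩
    · simp [inner_planeEmb]
      ring

/-- An image whose derivative at the centre of a disc is injective has at most one `L¹` median on
this disc. -/
theorem l1Median_unique {f : ImgPlane → ChanSpace} {x₀ : ImgPlane} {ρ : ℝ} (hρ : 0 < ρ)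
    (hf : ContinuousOn f (Metric.closedBall x₀ ρ))
    (hD : HasFDerivAt f planeEmb.toContinuousLinearMap x₀) {z₁ z₂ : ChanSpace}
    (h₁ : ∀ z, ∫ x in Metric.closedBall x₀ ρ, ‖f x - z₁‖ ≤ ∫ x in Metric.closedBall x₀ ρ, ‖f x - z‖)
    (h₂ : ∀ z, ∫ x in Metric.closedBall x₀ ρ, ‖f x - z₂‖
      ≤ ∫ x in Metric.closedBall x₀ ρ, ‖f x - z‖) : z₁ = z₂ := by
  by_contra hne
  set S := Metric.closedBall x₀ ρ
  have hSc : IsCompact S := isCompact_closedBall x₀ ρ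
  have hi : ∀ z : ChanSpace, IntegrableOn (fun x => ‖f x - z‖) S := fun z =>
    (hf.sub continuousOn_const).norm.integrableOn_compact hSc
  set mid : ChanSpace := (1 / 2 : ℝ) • (z₁ + z₂) with hmid
  -- The triangle defect at the midpoint is nonnegative; minimality of both points makes its
  -- integral zero.
  set g : ImgPlane → ℝ := fun x => ‖f x - z₁‖ + ‖f x - z₂‖ - 2 * ‖f x - mid‖ with hg
  have hsum : ∀ x, 2 * ‖f x - mid‖ = ‖(f x - z₁) + (f x - z₂)‖ := by
    intro x
    rw [show (f x - z₁) + (f x - z₂) = (2 : ℝ) • (f x - mid) by rw [hmid]; module, norm_smul]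
    simp
  have hg0 : ∀ x, 0 ≤ g x := fun x => by
    simp only [hg, hsum, sub_nonneg]; exact norm_add_le _ _
  have hgi : IntegrableOn g S := ((hi z₁).add (hi z₂)).sub ((hi mid).const_mul 2)
  have hgint : ∫ x in S, g x = 0 := by
    refine le_antisymm ?_ (integral_nonneg hg0)
    have hadd : IntegrableOn (fun x => ‖f x - z₁‖ + ‖f x - z₂‖) S := (hi z₁).add (hi z₂)
    simp only [hg]
    rw [integral_sub hadd ((hi mid).const_mul 2), integral_add (hi z₁) (hi z₂),
      integral_const_mul]
    linarith [h₁ mid, h₂ mid]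
  have hgae : g =ᵐ[volume.restrict S] 0 :=
    (setIntegral_eq_zero_iff_of_nonneg_ae (Eventually.of_forall hg0) hgi).1 hgint
  have hgball : Set.EqOn g 0 (Metric.ball x₀ ρ) := by
    refine Measure.eqOn_open_of_ae_eq (μ := volume)
      (ae_restrict_of_ae_restrict_of_subset Metric.ball_subset_closedBall hgae) Metric.isOpen_ball
      ?_ continuousOn_const
    have hf' := hf.mono (Metric.ball_subset_closedBall (x := x₀) (ε := ρ))
    exact (((hf'.sub continuousOn_const).norm.add (hf'.sub continuousOn_const).norm).sub
      ((hf'.sub continuousOn_const).norm.const_smul (2 : ℝ)))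
  obtain ⟨k, hk0, hk⟩ := exists_planeEmb_inner_eq_zero (z₂ - z₁)
  have hconst : ∀ᶠ x in 𝓝 x₀, inner ℝ (planeEmb k) (f x) = inner ℝ (planeEmb k) z₁ := by
    filter_upwards [Metric.ball_mem_nhds x₀ hρ] with x hx
    have h3 : g x = 0 := hgball hx
    -- Equality in the triangle inequality puts f x on the line through z₁ and z₂, to which planeEmb
    -- k is orthogonal.
    have hray : SameRay ℝ (f x - z₁) (f x - z₂) := by
      rw [sameRay_iff_norm_add, ← hsum]
      simp only [hg] at h3
      linarith
    obtain ⟨s, t, -, -, -, e1, e2⟩ := hray.exists_eq_smul_add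
    set v := f x - z₁ + (f x - z₂)
    have e3 : z₂ - z₁ = (s - t) • v := by
      rw [sub_smul, ← e1, ← e2]; abel
    rw [e3, inner_smul_right] at hk
    have hst : s - t ≠ 0 := by
      intro h0
      rw [h0, zero_smul, sub_eq_zero] at e3
      exact hne e3.symm
    have hv := (mul_eq_zero.1 hk).resolve_left hst
    have : inner ℝ (planeEmb k) (f x - z₁) = 0 := by rw [e1, inner_smul_right, hv, mul_zero]
    rwa [inner_sub_right, sub_eq_zero] at this
  have hd1 := ((innerSL ℝ (planeEmb k)).hasFDerivAt (x := f x₀)).comp x₀ hD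
  have hd2 : HasFDerivAt ((innerSL ℝ (planeEmb k)) ∘ f) (0 : ImgPlane →L[ℝ] ℝ) x₀ := by
    refine (hasFDerivAt_const (inner ℝ (planeEmb k) z₁) x₀).congr_of_eventuallyEq ?_
    filter_upwards [hconst] with x hx using by simpa using hx
  -- In direction k the two derivatives are ‖k‖² and 0.
  have h5 := congrArg (fun T : ImgPlane →L[ℝ] ℝ => T k) (hd1.unique hd2)
  simp at h5
  exact hk0 h5

/-! ### Rescaling and asymptotics of the median -/

/-- Rescaling of the objective function of the median to the unit disc. -/
theorem setIntegral_norm_sub_rescale (f : ImgPlane → ChanSpace) (x₀ : ImgPlane) {ρ : ℝ}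
    (hρ : 0 < ρ) (ζ : ChanSpace) :
    ∫ x in Metric.closedBall x₀ ρ, ‖f x - (f x₀ + ρ ^ 2 • ζ)‖
      = ρ ^ 3 * ∫ y in Metric.closedBall (0 : ImgPlane) 1, ‖planeEmb y
        + ρ • ((ρ ^ 2)⁻¹ • (f (x₀ + ρ • y) - f x₀ - planeEmb (ρ • y)) - ζ)‖ := by
  have h1 := Measure.setIntegral_comp_smul_of_pos (volume : Measure ImgPlane)
    (fun x => ‖f (x₀ + x) - (f x₀ + ρ ^ 2 • ζ)‖) (Metric.closedBall 0 1) hρ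
  rw [smul_unitClosedBall_of_nonneg hρ.le] at h1
  have h2 := (measurePreserving_add_left (volume : Measure ImgPlane) x₀).setIntegral_preimage_emb
    (measurableEmbedding_addLeft x₀) (fun x => ‖f x - (f x₀ + ρ ^ 2 • ζ)‖)
    (Metric.closedBall x₀ ρ)
  have h3 : (fun x => x₀ + x) ⁻¹' Metric.closedBall x₀ ρ = Metric.closedBall 0 ρ := by
    ext x; simp
  rw [h3] at h2
  rw [h2] at h1
  have h4 : ∀ y : ImgPlane, ‖f (x₀ + ρ • y) - (f x₀ + ρ ^ 2 • ζ)‖ = ρ * ‖planeEmb y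
      + ρ • ((ρ ^ 2)⁻¹ • (f (x₀ + ρ • y) - f x₀ - planeEmb (ρ • y)) - ζ)‖ := by
    intro y
    rw [← norm_smul_of_nonneg hρ.le]
    congr 1
    rw [map_smul, smul_add, smul_sub, smul_sub, smul_smul, smul_smul, smul_smul,
      show ρ * ρ * (ρ ^ 2)⁻¹ = 1 by field_simp]
    module
  simp only [h4] at h1
  rw [integral_const_mul, finrank_euclideanSpace_fin, smul_eq_mul] at h1
  -- Two powers of ρ come from area, one from the norm.
  rw [show ρ ^ 3 = ρ ^ 2 * ρ by ring, mul_assoc, h1, ← mul_assoc, mul_inv_cancel₀ (by positivity), one_mul]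

theorem isL1Median_iff {f : ImgPlane → ChanSpace} {S : Set ImgPlane} (hf : IntegrableOn f S)
    (m : ChanSpace) :
    IsL1Median f S m ↔ ∀ z, ∫ x in S, ‖f x - m‖ ≤ ∫ x in S, ‖f x - z‖ :=
  ⟨fun h => h.2, fun h => ⟨hf, h⟩⟩

theorem norm_planeQuad_le (a b d : ChanSpace) (y : ImgPlane) :
    ‖planeQuad a b d y‖ ≤ (‖a‖ + 2 * ‖b‖ + ‖d‖) * ‖y‖ ^ 2 := by
  have h0 : |y 0| ≤ ‖y‖ := PiLp.norm_apply_le y 0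
  have h1 : |y 1| ≤ ‖y‖ := PiLp.norm_apply_le y 1
  have e0 : y 0 ^ 2 ≤ ‖y‖ ^ 2 := sq_le_sq.2 (by simpa using h0)
  have e1 : y 1 ^ 2 ≤ ‖y‖ ^ 2 := sq_le_sq.2 (by simpa using h1)
  have e2 : |y 0 * y 1| ≤ ‖y‖ ^ 2 := by
    rw [abs_mul, sq]; gcongr
  rw [planeQuad, norm_smul]
  have : ‖y 0 ^ 2 • a + (2 * (y 0 * y 1)) • b + y 1 ^ 2 • d‖
      ≤ (‖a‖ + 2 * ‖b‖ + ‖d‖) * ‖y‖ ^ 2 := by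
    refine (norm_add₃_le).trans ?_
    rw [norm_smul, norm_smul, norm_smul, Real.norm_of_nonneg (sq_nonneg _),
      Real.norm_of_nonneg (sq_nonneg _), Real.norm_eq_abs, abs_mul, abs_two]
    calc _ ≤ ‖y‖ ^ 2 * ‖a‖ + 2 * ‖y‖ ^ 2 * ‖b‖ + ‖y‖ ^ 2 * ‖d‖ := by gcongr
      _ = _ := by ring
  have h2 : ‖(1 / 2 : ℝ)‖ = 1 / 2 := by norm_num
  rw [h2]
  linarith [norm_nonneg (y 0 ^ 2 • a + (2 * (y 0 * y 1)) • b + y 1 ^ 2 • d)]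

theorem planeQuad_smul (a b d : ChanSpace) (c : ℝ) (y : ImgPlane) :
    planeQuad a b d (c • y) = c ^ 2 • planeQuad a b d y := by
  simp only [planeQuad, PiLp.smul_apply, smul_eq_mul]
  module

/-- Existence, uniqueness and second-order asymptotics of the `L¹` median over small discs, for an
image whose derivative at the centre is the standard embedding. -/
theorem eventually_l1Median {f : ImgPlane → ChanSpace} {x₀ : ImgPlane} {Ω : Set ImgPlane}
    (hΩ : x₀ ∈ interior Ω) (hf : ∀ᶠ x in 𝓝 x₀, ContinuousAt f x) {a b d : ChanSpace}
    (hT : (fun h => f (x₀ + h) - f x₀ - planeEmb h - planeQuad a b d h)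
      =o[𝓝 0] fun h => ‖h‖ ^ 2) {δ : ℝ} (hδ : 0 < δ) :
    ∀ᶠ ρ in 𝓝[>] (0 : ℝ), ∃ m, (∀ z, IsL1Median f (Metric.closedBall x₀ ρ ∩ Ω) z ↔ z = m) ∧
      ‖m - (f x₀ + ρ ^ 2 • medianShift a b d)‖ ≤ δ * ρ ^ 2 := by
  obtain ⟨r, hr, hball⟩ := Metric.eventually_nhds_iff_ball.1
    (hf.and (mem_interior_iff_mem_nhds.1 hΩ))
  have hsmall : ∀ᶠ ρ in 𝓝[>] (0 : ℝ), 0 < ρ ∧ ρ < r :=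
    (eventually_mem_nhdsWithin).and (nhdsWithin_le_nhds (eventually_lt_nhds hr))
  have hsub : ∀ ρ, ρ < r → Metric.closedBall x₀ ρ ⊆ Metric.ball x₀ r := fun ρ h =>
    Metric.closedBall_subset_ball h
  have hfc : ∀ ρ, ρ < r → ContinuousOn f (Metric.closedBall x₀ ρ) := fun ρ h x hx =>
    (hball x (hsub ρ h hx)).1.continuousWithinAt
  have hD : HasFDerivAt f planeEmb.toContinuousLinearMap x₀ := by
    rw [hasFDerivAt_iff_isLittleO_nhds_zero]
    have hsq : (fun h : ImgPlane => ‖h‖ ^ 2) =o[𝓝 0] fun h => h := by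
      simpa using (isLittleO_norm_pow_id (E' := ImgPlane) (n := 2) one_lt_two)
    have hQ : planeQuad a b d =O[𝓝 0] fun h : ImgPlane => ‖h‖ ^ 2 :=
      IsBigO.of_bound (‖a‖ + 2 * ‖b‖ + ‖d‖) (Eventually.of_forall fun h => by
        simpa using norm_planeQuad_le a b d h)
    refine ((hT.trans hsq).add (hQ.trans_isLittleO hsq)).congr_left fun h => ?_
    simp
  set q : ℝ → ImgPlane → ChanSpace := fun ρ y =>
    (ρ ^ 2)⁻¹ • (f (x₀ + ρ • y) - f x₀ - planeEmb (ρ • y)) with hq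
  have hcont : ∀ᶠ ρ in 𝓝[>] (0 : ℝ), ContinuousOn (q ρ) (Metric.closedBall 0 1) := by
    filter_upwards [hsmall] with ρ hρ
    have hmaps : Set.MapsTo (fun y : ImgPlane => x₀ + ρ • y) (Metric.closedBall 0 1)
        (Metric.closedBall x₀ ρ) := by
      intro y hy
      have hy : ‖y‖ ≤ 1 := by simpa using hy
      simp only [mem_closedBall_iff_norm, add_sub_cancel_left, norm_smul,
        Real.norm_of_nonneg hρ.1.le]
      nlinarith [hρ.1]
    have h1 := (hfc ρ hρ.2).comp (f := fun y : ImgPlane => x₀ + ρ • y) (by fun_prop) hmaps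
    have h2 : Continuous fun y : ImgPlane => planeEmb (ρ • y) :=
      planeEmb.continuous.comp (continuous_const_smul ρ)
    exact ((h1.sub continuousOn_const).sub h2.continuousOn).const_smul ((ρ ^ 2)⁻¹)
  -- Uniform in y, since the Peano remainder is evaluated at ρ • y, of norm at most ρ.
  have hclose : ∀ ε > 0, ∀ᶠ ρ in 𝓝[>] (0 : ℝ), ∀ y ∈ Metric.closedBall (0 : ImgPlane) 1,
      ‖q ρ y - planeQuad a b d y‖ ≤ ε := by
    intro ε hε
    obtain ⟨s, hs, hT'⟩ := Metric.eventually_nhds_iff_ball.1 (hT.def hε)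
    filter_upwards [eventually_mem_nhdsWithin, nhdsWithin_le_nhds (eventually_lt_nhds hs)]
      with ρ h0 hρs y hy
    have h0 : 0 < ρ := h0
    have hy : ‖y‖ ≤ 1 := by simpa using hy
    have hn : ‖ρ • y‖ ≤ ρ := by
      rw [norm_smul, Real.norm_of_nonneg h0.le]; nlinarith
    have h1 := hT' (ρ • y) (by simpa using hn.trans_lt hρs)
    have h2 : q ρ y - planeQuad a b d y
        = (ρ ^ 2)⁻¹ • (f (x₀ + ρ • y) - f x₀ - planeEmb (ρ • y) - planeQuad a b d (ρ • y)) := by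
      rw [planeQuad_smul, smul_sub _ _ (ρ ^ 2 • _), smul_smul, inv_mul_cancel₀ (by positivity),
        one_smul]
    rw [h2, norm_smul, Real.norm_of_nonneg (by positivity)]
    rw [Real.norm_of_nonneg (sq_nonneg ‖ρ • y‖)] at h1
    calc _ ≤ (ρ ^ 2)⁻¹ * (ε * ‖ρ • y‖ ^ 2) := by gcongr
      _ ≤ (ρ ^ 2)⁻¹ * (ε * ρ ^ 2) := by gcongr
      _ = ε := by field_simp
  have hbound : ∀ᶠ ρ in 𝓝[>] (0 : ℝ), ∀ y ∈ Metric.closedBall (0 : ImgPlane) 1,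
      ‖q ρ y‖ ≤ 1 + (‖a‖ + 2 * ‖b‖ + ‖d‖) := by
    filter_upwards [hclose 1 one_pos] with ρ hρ y hy
    have hy' : ‖y‖ ≤ 1 := by simpa using hy
    have h1 : ‖planeQuad a b d y‖ ≤ (‖a‖ + 2 * ‖b‖ + ‖d‖) * 1 :=
      (norm_planeQuad_le a b d y).trans (by gcongr; exact pow_le_one₀ (norm_nonneg _) hy')
    have h2 := norm_add_le (q ρ y - planeQuad a b d y) (planeQuad a b d y)
    rw [sub_add_cancel] at h2
    linarith [hρ y hy]
  have hlim : ∀ y ∈ Metric.closedBall (0 : ImgPlane) 1,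
      Tendsto (fun ρ => q ρ y) (𝓝[>] 0) (𝓝 (planeQuad a b d y)) := by
    intro y hy
    rw [Metric.tendsto_nhds]
    intro ε hε
    filter_upwards [hclose (ε / 2) (by positivity)] with ρ hρ
    rw [dist_eq_norm]
    linarith [hρ y hy]
  filter_upwards [hsmall, eventually_lt_sphere_medianShift hcont hbound hlim hδ] with ρ hρ hsph
  have hρ2 : 0 < ρ ^ 2 := pow_pos hρ.1 2
  have hinter : Metric.closedBall x₀ ρ ∩ Ω = Metric.closedBall x₀ ρ :=
    Set.inter_eq_left.2 fun x hx => (hball x (hsub ρ hρ.2 hx)).2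
  rw [hinter]
  have hcpt := isCompact_closedBall x₀ ρ
  have hlt : ∀ z ∈ Metric.sphere (f x₀ + ρ ^ 2 • medianShift a b d) (δ * ρ ^ 2),
      ∫ x in Metric.closedBall x₀ ρ, ‖f x - (f x₀ + ρ ^ 2 • medianShift a b d)‖
        < ∫ x in Metric.closedBall x₀ ρ, ‖f x - z‖ := by
    intro z hz
    set ζ : ChanSpace := (ρ ^ 2)⁻¹ • (z - f x₀) with hζ
    have hz' : z = f x₀ + ρ ^ 2 • ζ := by
      rw [hζ, smul_smul, mul_inv_cancel₀ hρ2.ne', one_smul]; abel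
    have hζs : ζ ∈ Metric.sphere (medianShift a b d) δ := by
      rw [mem_sphere_iff_norm] at hz ⊢
      rw [hz', add_sub_add_left_eq_sub, ← smul_sub, norm_smul, Real.norm_of_nonneg hρ2.le,
        mul_comm] at hz
      exact mul_right_cancel₀ hρ2.ne' hz
    rw [hz', setIntegral_norm_sub_rescale f x₀ hρ.1, setIntegral_norm_sub_rescale f x₀ hρ.1]
    exact mul_lt_mul_of_pos_left (hsph ζ hζs) (pow_pos hρ.1 3)
  obtain ⟨⟨m, hm⟩, hloc⟩ := (convexOn_setIntegral_norm_sub hcpt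
    (hfc ρ hρ.2)).exists_forall_le_of_lt_sphere (by positivity) hlt
  refine ⟨m, fun z => ?_, ?_⟩
  · rw [isL1Median_iff ((hfc ρ hρ.2).integrableOn_compact hcpt)]
    refine ⟨fun hz => l1Median_unique hρ.1 (hfc ρ hρ.2) hD hz hm, ?_⟩
    rintro rfl
    exact hm
  · rw [← dist_eq_norm]
    exact hloc m hm

/-! ### Linear algebra of the affine transformation -/

/-- The action of a matrix on channel vectors as a continuous linear map. -/
noncomputable def chanCLM (M : Matrix (Fin 3) (Fin 3) ℝ) : ChanSpace →L[ℝ] ChanSpace :=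
  LinearMap.toContinuousLinearMap
    { toFun := chanApply M
      map_add' := fun v w => by simp [chanApply, Matrix.mulVec_add]
      map_smul' := fun c v => by simp [chanApply, Matrix.mulVec_smul] }

theorem chanCLM_apply (M : Matrix (Fin 3) (Fin 3) ℝ) (v : ChanSpace) :
    chanCLM M v = chanApply M v := rfl

theorem chanApply_chanApply (M N : Matrix (Fin 3) (Fin 3) ℝ) (v : ChanSpace) :
    chanApply M (chanApply N v) = chanApply (M * N) v := by
  simp [chanApply]

/-- The determinant is the squared length of the cross product, nonzero for independent columns. -/
theorem isUnit_det_enlargedJacobian {D : Matrix (Fin 3) (Fin 2) ℝ} (hD : D.rank = 2) :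
    IsUnit (enlargedJacobian D).det := by
  have hli : LinearIndependent ℝ D.col := by
    rw [linearIndependent_iff_card_eq_finrank_span, Set.finrank, ← D.rank_eq_finrank_span_cols, hD]
    simp
  have hc : D.col = ![D.col 0, D.col 1] := by
    ext i; fin_cases i <;> rfl
  rw [hc, ← crossProduct_ne_zero_iff_linearIndependent] at hli
  have hdet : (enlargedJacobian D).det
      = crossProduct (D.col 0) (D.col 1) ⬝ᵥ crossProduct (D.col 0) (D.col 1) := by
    rw [enlargedJacobian, Matrix.det_transpose]
    simp [Matrix.det_fin_three, cross_apply]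
    ring
  rw [isUnit_iff_ne_zero, hdet]
  exact fun h => hli (dotProduct_self_eq_zero.1 h)

theorem chanApply_enlargedJacobian (D : Matrix (Fin 3) (Fin 2) ℝ) (y : ImgPlane) :
    chanApply (enlargedJacobian D) (planeEmb y) = WithLp.toLp 2 (y 0 • D.col 0 + y 1 • D.col 1) := by
  ext i
  fin_cases i <;>
    simp [chanApply, enlargedJacobian, planeEmb_apply, Matrix.mulVec, dotProduct,
      Fin.sum_univ_three] <;> ring

/-- In this form, conjugation by `enlargedJacobian` produces `coeffMatA` and `coeffMatB`. -/
theorem medianShift_eq (a b d : ChanSpace) :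
    medianShift a b d = (1 / 24 : ℝ) • ((2 : ℝ) • (a + d)
      + chanApply (Matrix.diagonal ![1, -1, 0]) (d - a)
      - (2 : ℝ) • chanApply !![0, 1, 0; 1, 0, 0; 0, 0, 0] b) := by
  ext i
  fin_cases i <;>
    simp [medianShift, chanApply, Matrix.mulVec, dotProduct, Fin.sum_univ_three] <;> ring

theorem imgPlane_eq (h : ImgPlane) :
    h = h 0 • EuclideanSpace.single 0 1 + h 1 • EuclideanSpace.single 1 1 := by
  ext i; fin_cases i <;> simp

theorem imgPartial_imgPartial {u : ImgPlane → ChanSpace} {x : ImgPlane} (hu : ContDiffAt ℝ 2 u x)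
    (i j : Fin 2) : imgPartial i (imgPartial j u) x
      = fderiv ℝ (fderiv ℝ u) x (EuclideanSpace.single i 1) (EuclideanSpace.single j 1) := by
  have hd2 : DifferentiableAt ℝ (fderiv ℝ u) x :=
    (hu.fderiv_right (m := 1) (by norm_num)).differentiableAt (by simp)
  have h := hd2.hasFDerivAt.clm_apply
    (hasFDerivAt_const (EuclideanSpace.single j 1 : ImgPlane) x)
  have h' : fderiv ℝ (imgPartial j u) x = _ := h.fderiv
  rw [imgPartial, h']
  simp

/-! ### The filter step and the PDE -/

theorem mainTheorem5 (Ω : Set ImgPlane) (u : ImgPlane → ChanSpace) (x₀ : ImgPlane)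
    (hx₀ : x₀ ∈ interior Ω) (hu : ContDiffAt ℝ 2 u x₀)
    (hrank : (imgJacobian u x₀).rank = 2) :
    ∃ uStar : ℝ → ChanSpace,
      (∀ᶠ ρ in 𝓝[>] (0 : ℝ), ∀ z : ChanSpace,
        IsAffineL1MedianValue Ω u ρ x₀ z ↔ z = uStar ρ) ∧
      (fun ρ : ℝ => uStar ρ - (u x₀ + (ρ ^ 2 / 24) • medianPdeRhs u x₀))
        =o[𝓝[>] (0 : ℝ)] (fun ρ : ℝ => ρ ^ 2) := by
  set D := imgJacobian u x₀ with hD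
  set M := enlargedJacobian D with hM
  have hdet : IsUnit M.det := isUnit_det_enlargedJacobian hrank
  have hinv : ∀ v, chanApply M (chanApply M⁻¹ v) = v := fun v => by
    rw [chanApply_chanApply, Matrix.mul_nonsing_inv _ hdet]; simp [chanApply]
  have hinv' : ∀ v, chanApply M⁻¹ (chanApply M v) = v := fun v => by
    rw [chanApply_chanApply, Matrix.nonsing_inv_mul _ hdet]; simp [chanApply]
  set f : ImgPlane → ChanSpace := fun x => chanApply M⁻¹ (u x) with hf
  set uxx := imgPartial 0 (imgPartial 0 u) x₀ with huxx
  set uyy := imgPartial 1 (imgPartial 1 u) x₀ with huyy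
  set uxy := imgPartial 1 (imgPartial 0 u) x₀ with huxy
  set a := chanApply M⁻¹ uxx with ha
  set b := chanApply M⁻¹ uxy with hb
  set d := chanApply M⁻¹ uyy with hd
  have hfirst : ∀ h, chanApply M⁻¹ (fderiv ℝ u x₀ h) = planeEmb h := by
    intro h
    rw [← hinv' (planeEmb h), hM, chanApply_enlargedJacobian]
    congr 1
    conv_lhs => rw [imgPlane_eq h]
    rw [map_add, map_smul, map_smul]
    ext i
    simp [hD, imgJacobian, imgPartial]
  have hsecond : ∀ h, chanApply M⁻¹ ((1 / 2 : ℝ) • fderiv ℝ (fderiv ℝ u) x₀ h h)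
      = planeQuad a b d h := by
    intro h
    have hsymm : fderiv ℝ (fderiv ℝ u) x₀ (EuclideanSpace.single 0 1) (EuclideanSpace.single 1 1)
        = uxy := by
      rw [huxy, imgPartial_imgPartial hu]
      exact (hu.isSymmSndFDerivAt (by simp)).eq _ _
    have hexp : fderiv ℝ (fderiv ℝ u) x₀ h h
        = h 0 ^ 2 • uxx + (2 * (h 0 * h 1)) • uxy + h 1 ^ 2 • uyy := by
      conv_lhs => rw [imgPlane_eq h]
      simp only [map_add, map_smul, add_apply, smul_apply, hsymm]
      rw [← imgPartial_imgPartial hu, ← imgPartial_imgPartial hu, ← imgPartial_imgPartial hu]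
      module
    rw [hexp]
    simp only [← chanCLM_apply, map_add, map_smul, planeQuad, ha, hb, hd]
  have hT : (fun h => f (x₀ + h) - f x₀ - planeEmb h - planeQuad a b d h)
      =o[𝓝 0] fun h => ‖h‖ ^ 2 := by
    refine (((chanCLM M⁻¹).isBigO_comp _ _).trans_isLittleO hu.second_order_taylor).congr_left
      fun h => ?_
    rw [map_sub, map_sub, map_sub, chanCLM_apply, chanCLM_apply, chanCLM_apply, chanCLM_apply,
      hfirst, hsecond]
  have hfc : ∀ᶠ x in 𝓝 x₀, ContinuousAt f x := by
    filter_upwards [hu.eventually (by simp)] with x hx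
    exact (chanCLM M⁻¹).continuous.continuousAt.comp hx.continuousAt
  have hrhs : chanApply M (medianShift a b d) = (1 / 24 : ℝ) • medianPdeRhs u x₀ := by
    rw [medianShift_eq]
    simp only [medianPdeRhs, coeffMatA, coeffMatB, ← hD, ← hM, ← huxx, ← huyy, ← huxy]
    simp only [← chanApply_chanApply]
    rw [show chanApply M⁻¹ (uyy - uxx) = d - a from (chanCLM M⁻¹).map_sub uyy uxx, ← hb]
    have h1 : chanApply M a = uxx := hinv uxx
    have h2 : chanApply M d = uyy := hinv uyy
    simp only [← chanCLM_apply M, map_add, map_sub, map_smul]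
    simp only [chanCLM_apply, h1, h2]
  classical
  -- One function of ρ must serve every tolerance, although the admissible range of ρ depends on it;
  -- the value 0 occurs only where there is no unique median.
  let m : ℝ → ChanSpace := fun ρ => if h : ∃ m, ∀ z,
    IsL1Median f (Metric.closedBall x₀ ρ ∩ Ω) z ↔ z = m then h.choose else 0
  have hm : ∀ ρ m', (∀ z, IsL1Median f (Metric.closedBall x₀ ρ ∩ Ω) z ↔ z = m') → m ρ = m' := by
    intro ρ m' h
    have hex : ∃ m, ∀ z, IsL1Median f (Metric.closedBall x₀ ρ ∩ Ω) z ↔ z = m := ⟨m', h⟩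
    have : m ρ = hex.choose := dif_pos hex
    rw [this]
    exact (h _).1 ((hex.choose_spec _).2 rfl)
  refine ⟨fun ρ => chanApply M (m ρ), ?_, ?_⟩
  · filter_upwards [eventually_l1Median hx₀ hfc hT one_pos] with ρ hρ z
    obtain ⟨m', hm', -⟩ := hρ
    rw [hm ρ m' hm']
    constructor
    · rintro ⟨w, hw, rfl⟩
      rw [(hm' w).1 hw]
    · rintro rfl
      exact ⟨m', (hm' m').2 rfl, rfl⟩
  · have hlo : (fun ρ => m ρ - (f x₀ + ρ ^ 2 • medianShift a b d))
        =o[𝓝[>] (0 : ℝ)] fun ρ : ℝ => ρ ^ 2 := by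
      rw [isLittleO_iff]
      intro c hc
      filter_upwards [eventually_l1Median hx₀ hfc hT hc] with ρ hρ
      obtain ⟨m', hm', hle⟩ := hρ
      rw [hm ρ m' hm', Real.norm_of_nonneg (sq_nonneg ρ)]
      exact hle
    refine (((chanCLM M).isBigO_comp _ _).trans_isLittleO hlo).congr_left fun ρ => ?_
    rw [map_sub, map_add, map_smul]
    simp only [chanCLM_apply, hrhs]
    rw [hf, hinv, smul_smul, mul_one_div]
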